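/- Let $L=\{L(y):y\ge 0\}$ be an increasing additive process on a probability space $(\Omega,\mathcal F,P)$: $L$ is real valued, $L(0)=0$ a.s., $L$ has independent increments, and its paths are a.s. nondecreasing and right continuous. Let $\nu(y,dv)$, $y\ge 0$, be its Lévy measures on $(0,\infty)$, i.e. $\int_{(0,\infty)}\min(1,v)\,\nu(y,dv)<\infty$ and $E[e^{-\lambda L(y)}]=\exp\{-\int_{(0,\infty)}(1-e^{-\lambda v})\,\nu(y,dv)\}$ for all $y,\lambda\ge 0$. Let $\alpha$ be a finite nonzero measure on $\mathbb R$, $A(x)=\alpha((-\infty,x])$, and $L_A(x)=L(A(x))$, $x\in\mathbb R$. Let $\tilde\nu_\alpha$ be the Poisson intensity measure of $L_A$ on $\mathbb R\times(0,\infty)$, i.e. the measure with $\tilde\nu_\alpha((-\infty,x]\times C)=\nu(A(x),C)$ for all $x\in\mathbb R$ and all Borel $C\subseteq(0,\infty)$. Let $k:\mathbb R\times\mathbb R\to[0,\infty)$ be such that $k(t,\cdot)$ is Borel measurable for every $t$, and such that: (I) for every $x$, the map $t\mapsto k(t,x)$ is nondecreasing and right continuous, and $\lim_{t\to-\infty}k(t,x)=0$.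 Suppose moreover that the limit $\bar k(x)=\lim_{t\to+\infty}k(t,x)$ is finite for every $x$. Define pathwise the $[0,\infty]$-valued Lebesgue–Stieltjes integrals $Z(t)=\int_{\mathbb R}k(t,x)\,dL_A(x)$, $t\in\mathbb R$, and put $\bar Z=\lim_{t\to+\infty}Z(t)\in[0,\infty]$ (the limit exists a.s.). Consider the conditions (II) $\int_{\mathbb R\times(0,\infty)}[1-e^{-\lambda v\bar k(x)}]\,\tilde\nu_\alpha(dx\,dv)<\infty$ for every $\lambda>0$; (III) $\tilde\nu_\alpha(\mathbb R\times(0,\infty))=\infty$. Then: (a) $\bar Z<\infty$ a.s. if and only if (II) holds. (b) If (II) holds, then $Z=\{Z(t):t\in\mathbb R\}$ is a.s. a random distribution function: each $Z(t)$ is a random variable (up to a $P$-null set), and almost every path $t\mapsto Z(t)$ is finite, bounded, nondecreasing, right continuous and tends to $0$ as $t\to-\infty$. (c) Suppose in addition that $\bar k>0$ holds $\tilde\nu_\alpha$-almost everywhere, i.e. $\tilde\nu_\alpha(\{x:\bar k(x)=0\}\times(0,\infty))=0$ (for instance, that $\bar k(x)>0$ for every $x$). Then $\bar Z>0$ a.s.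 if and only if (III) holds. If both (II) and (III) hold, then $F=\{F(t)=Z(t)/\bar Z:t\in\mathbb R\}$ is a.s. a random probability distribution function, i.e. each $F(t)$ is a random variable (up to a $P$-null set) and almost every path is nondecreasing and right continuous with limits $0$ at $-\infty$ and $1$ at $+\infty$. -/

import Mathlib

open MeasureTheory ProbabilityTheory Filter Set Topology
open scoped NNReal ENNReal

namespace IAP

variable {Ω : Type*} [MeasurableSpace Ω]

/-- `L` is an increasing additive process on the time set `[0, ∞)`: a real-valued (hence finite)
process started at `0`, with independent increments, whose sample paths are almost surely
nondecreasing and right continuous. -/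
structure IsIncreasingAdditive (L : ℝ≥0 → Ω → ℝ) (P : Measure Ω) : Prop where
  measurable : ∀ y, Measurable (L y)
  zero : ∀ᵐ ω ∂P, L 0 ω = 0
  indep : HasIndepIncrements L P
  paths : ∀ᵐ ω ∂P, Monotone (fun y => L y ω) ∧
    ∀ y, ContinuousWithinAt (fun y => L y ω) (Ici y) y

/-- `ν y`, `y ≥ 0`, is the family of Lévy measures (on `(0, ∞)`) of the increasing process `L`,
in the sense of the Lévy-Khintchine representation
`E[exp(-s L(y))] = exp(-∫_{(0,∞)} (1 - exp(-s v)) ν(y, dv))`, `s ≥ 0`.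
Only the restrictions of the `ν y` to `(0, ∞)` matter. -/
structure HasLevyMeasures (L : ℝ≥0 → Ω → ℝ) (ν : ℝ≥0 → Measure ℝ) (P : Measure Ω) : Prop where
  integrable : ∀ y, ∫⁻ v in Ioi (0 : ℝ), ENNReal.ofReal (min 1 v) ∂(ν y) < ∞
  laplace : ∀ y, ∀ s : ℝ, 0 ≤ s →
    ∫ ω, Real.exp (-(s * L y ω)) ∂P =
      Real.exp (-∫ v in Ioi (0 : ℝ), (1 - Real.exp (-(s * v))) ∂(ν y))

/-- The distribution function `A(x) = α((-∞, x])` of a finite measure `α` on the line. -/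
noncomputable def distFun (α : Measure ℝ) (x : ℝ) : ℝ≥0 := (α (Iic x)).toNNReal

/-- The reparameterized process `L_A(x) = L(A(x))`, `x ∈ ℝ`. -/
noncomputable def timeChange (L : ℝ≥0 → Ω → ℝ) (α : Measure ℝ) (x : ℝ) (ω : Ω) : ℝ :=
  L (distFun α x) ω

/-- `νt` is the Poisson intensity measure on `ℝ × (0, ∞)` of the reparameterized process:
`νt((-∞, x] × C) = ν_α(x, C)` with `ν_α(x, ·) = ν(A(x), ·)`, for every real `x` and every Borel
subset `C` of `(0, ∞)`. This determines `νt` on `ℝ × (0, ∞)`; its values elsewhere are never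
used. -/
def IsPoissonIntensity (νt : Measure (ℝ × ℝ)) (ν : ℝ≥0 → Measure ℝ) (α : Measure ℝ) : Prop :=
  ∀ x : ℝ, ∀ C : Set ℝ, MeasurableSet C → C ⊆ Ioi 0 → νt (Iic x ×ˢ C) = ν (distFun α x) C

open Classical in
/-- The Lebesgue-Stieltjes measure `dg` of a nondecreasing right continuous function `g`
(and the zero measure if `g` is not of this kind). -/
noncomputable def stieltjes (g : ℝ → ℝ) : Measure ℝ :=
  if h : Monotone g ∧ ∀ x, ContinuousWithinAt g (Ici x) x then
    (StieltjesFunction.mk g h.1 h.2).measure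
  else 0

/-- `Z(t) = ∫ k(t, x) dL_A(x)`, as a pathwise Lebesgue-Stieltjes integral with values in
`[0, ∞]`. -/
noncomputable def Z (k : ℝ → ℝ → ℝ≥0) (L : ℝ≥0 → Ω → ℝ) (α : Measure ℝ) (t : ℝ) (ω : Ω) : ℝ≥0∞ :=
  ∫⁻ x, (k t x : ℝ≥0∞) ∂(stieltjes fun x => timeChange L α x ω)

/-- `Z̄ = lim_{t → +∞} Z(t)`, with values in `[0, ∞]`. -/
noncomputable def Zbar (k : ℝ → ℝ → ℝ≥0) (L : ℝ≥0 → Ω → ℝ) (α : Measure ℝ) (ω : Ω) : ℝ≥0∞ :=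
  limUnder atTop fun t => Z k L α t ω

/-- `F(t) = Z(t) / Z̄`. -/
noncomputable def F (k : ℝ → ℝ → ℝ≥0) (L : ℝ≥0 → Ω → ℝ) (α : Measure ℝ) (t : ℝ) (ω : Ω) : ℝ :=
  (Z k L α t ω).toReal / (Zbar k L α ω).toReal

/-- Condition (I) on the kernel: `t ↦ k(t, x)` is nondecreasing and right continuous and vanishes
at `-∞`, for every `x`. -/
structure CondI (k : ℝ → ℝ → ℝ≥0) : Prop where
  mono : ∀ x, Monotone fun t => k t x
  right_cont : ∀ x t, ContinuousWithinAt (fun t => k t x) (Ici t) t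
  atBot : ∀ x, Tendsto (fun t => k t x) atBot (𝓝 0)

/-- Condition (II): `∫_{ℝ × (0,∞)} (1 - exp(-s v k̄(x))) νt(dx dv) < ∞` for every `s > 0`. -/
def CondII (kbar : ℝ → ℝ≥0) (νt : Measure (ℝ × ℝ)) : Prop :=
  ∀ s : ℝ, 0 < s →
    ∫⁻ p in univ ×ˢ Ioi (0 : ℝ), ENNReal.ofReal (1 - Real.exp (-(s * p.2 * kbar p.1))) ∂νt < ∞

/-- Condition (III): `νt(ℝ × (0, ∞)) = ∞`. -/
def CondIII (νt : Measure (ℝ × ℝ)) : Prop := νt (univ ×ˢ Ioi (0 : ℝ)) = ∞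

/-- `G` is a distribution function (of a finite measure on the line). -/
structure IsDF (G : ℝ → ℝ) : Prop where
  mono : Monotone G
  right_cont : ∀ t, ContinuousWithinAt G (Ici t) t
  atBot : Tendsto G atBot (𝓝 0)
  bdd : BddAbove (range G)

/-- `G` is a probability distribution function. -/
structure IsProbDF (G : ℝ → ℝ) : Prop extends IsDF G where
  atTop : Tendsto G atTop (𝓝 1)

/-- The process `Y` (with values in `[0, ∞]`) is a random d.f. almost surely: each `Y(t)` is a
random variable and almost every sample path is finite and a d.f. -/
def IsRandomDF (Y : ℝ → Ω → ℝ≥0∞) (P : Measure Ω) : Prop :=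
  (∀ t, AEMeasurable (Y t) P) ∧
    ∀ᵐ ω ∂P, (∀ t, Y t ω < ∞) ∧ IsDF fun t => (Y t ω).toReal

/-- The real-valued process `Y` is a random probability d.f. almost surely. -/
def IsRandomProbDF (Y : ℝ → Ω → ℝ) (P : Measure Ω) : Prop :=
  (∀ t, AEMeasurable (Y t) P) ∧ ∀ᵐ ω ∂P, IsProbDF fun t => Y t ω

end IAP

/-! Everything follows from one formula for the random measure `dL_A`: for every measurable `f : ℝ →
[0, ∞]`, `E exp(-∫ f dL_A) = exp(-∫ (1 - exp(-v f(x))) νt(dx dv))`, with `exp(-∞) = 0`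
(`hasPoissonLaplace`). For step functions it combines independent increments with the
Lévy-Khintchine formula; limits extend it to continuous, bounded measurable and finally all
measurable `f`.

Let `W = ∫ k̄ dL_A`, which equals `Z̄` almost surely by monotone convergence. Taking `f = s k̄`
gives `E exp(-s W)`. If `W < ∞` a.s. this is positive, so the exponent, which is the integral in
(II), is finite. Conversely, under (II) the exponent tends to `0` as `s → 0`, while `E exp(-s W) ≤
P(W < ∞)`; hence `P(W < ∞) = 1` (`ae_lintegral_lt_top_iff_condII`). Taking `f = ∞ · k̄` gives `P(W =
0) = exp(-νt(ℝ × (0, ∞)))` when `k̄ > 0` holds `νt`-a.e., hence (III)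
(`ae_lintegral_pos_iff_condIII`). Path regularity of `Z` is dominated convergence, path by path,
with dominating function `k̄`. -/

namespace IAP

/-! ### The exponential `exp(-a)` on `[0, ∞]` -/

section ExpNeg

/-- The function `a ↦ exp(-a)` on `[0, ∞]`, with `exp(-∞) = 0`. -/
noncomputable def expNeg (a : ℝ≥0∞) : ℝ≥0∞ := EReal.exp (-(a : EReal))

@[simp] lemma expNeg_zero : expNeg 0 = 1 := by simp [expNeg]

@[simp] lemma expNeg_top : expNeg ∞ = 0 := by simp [expNeg]

lemma continuous_expNeg : Continuous expNeg :=
  ENNReal.continuous_exp.comp (continuous_neg.comp continuous_coe_ennreal_ereal)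

@[fun_prop]
lemma measurable_expNeg : Measurable expNeg := continuous_expNeg.measurable

lemma expNeg_le_expNeg_iff {a b : ℝ≥0∞} : expNeg a ≤ expNeg b ↔ b ≤ a := by
  simp [expNeg]

lemma antitone_expNeg : Antitone expNeg := fun _ _ h => expNeg_le_expNeg_iff.2 h

lemma expNeg_injective : Function.Injective expNeg := fun _ _ h =>
  le_antisymm (expNeg_le_expNeg_iff.1 h.ge) (expNeg_le_expNeg_iff.1 h.le)

lemma expNeg_le_one (a : ℝ≥0∞) : expNeg a ≤ 1 := by
  simpa using antitone_expNeg (zero_le : (0 : ℝ≥0∞) ≤ a)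

lemma expNeg_ne_top (a : ℝ≥0∞) : expNeg a ≠ ∞ :=
  ((expNeg_le_one a).trans_lt ENNReal.one_lt_top).ne

lemma expNeg_eq_zero_iff {a : ℝ≥0∞} : expNeg a = 0 ↔ a = ∞ := by
  rw [← expNeg_top, expNeg_injective.eq_iff]

lemma expNeg_add (a b : ℝ≥0∞) : expNeg (a + b) = expNeg a * expNeg b := by
  rw [expNeg, expNeg, expNeg, ← EReal.exp_add, EReal.coe_ennreal_add, EReal.neg_add,
    sub_eq_add_neg]
  · exact Or.inl (EReal.coe_ennreal_ne_bot a)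
  · exact Or.inr (EReal.coe_ennreal_ne_bot b)

lemma expNeg_sum {ι : Type*} (s : Finset ι) (a : ι → ℝ≥0∞) :
    expNeg (∑ i ∈ s, a i) = ∏ i ∈ s, expNeg (a i) := by
  classical
  induction s using Finset.induction_on with
  | empty => simp
  | insert i s hi ih => rw [Finset.sum_insert hi, Finset.prod_insert hi, expNeg_add, ih]

lemma expNeg_ofReal {x : ℝ} (hx : 0 ≤ x) :
    expNeg (ENNReal.ofReal x) = ENNReal.ofReal (Real.exp (-x)) := by
  rw [expNeg, EReal.coe_ennreal_ofReal, max_eq_left hx, ← EReal.coe_neg, EReal.exp_coe]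

lemma one_sub_expNeg_ofReal {x : ℝ} (hx : 0 ≤ x) :
    1 - expNeg (ENNReal.ofReal x) = ENNReal.ofReal (1 - Real.exp (-x)) := by
  rw [expNeg_ofReal hx, ENNReal.ofReal_sub _ (Real.exp_nonneg _), ENNReal.ofReal_one]

lemma one_sub_expNeg_add_le (a b : ℝ≥0∞) :
    1 - expNeg (a + b) ≤ (1 - expNeg a) + (1 - expNeg b) := by
  have ha := expNeg_le_one a
  have hb := expNeg_le_one b
  rw [expNeg_add, tsub_le_iff_right]
  calc (1 : ℝ≥0∞) = (1 - expNeg b) + ((1 - expNeg a) + expNeg a) * expNeg b := by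
        rw [tsub_add_cancel_of_le ha, one_mul, tsub_add_cancel_of_le hb]
    _ = (1 - expNeg b) + ((1 - expNeg a) * expNeg b + expNeg a * expNeg b) := by rw [add_mul]
    _ ≤ (1 - expNeg b) + ((1 - expNeg a) * 1 + expNeg a * expNeg b) := by gcongr
    _ = _ := by rw [mul_one]; ring

/-- By subadditivity, integrability of `1 - exp(-v)` passes to `1 - exp(-N v)`, the dominating
function for integrands `f ≤ N`. -/
lemma one_sub_expNeg_mul_natCast_le (a : ℝ≥0∞) (n : ℕ) :
    1 - expNeg (a * n) ≤ n * (1 - expNeg a) := by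
  induction n with
  | zero => simp
  | succ n ih =>
    push_cast
    rw [mul_add, add_mul, mul_one, one_mul]
    exact (one_sub_expNeg_add_le _ _).trans (by gcongr)

end ExpNeg

/-! ### Extension of the Laplace functional from step functions to measurable functions -/

section LaplaceFunctional

variable {Ω : Type*} [MeasurableSpace Ω]

/-- The Laplace functional of the random measure `κ` at `f` is that of the sums of the second
coordinates of a Poisson process with intensity `n` on `ℝ × (0, ∞)`. -/
def HasPoissonLaplace (P : Measure Ω) (κ : Ω → Measure ℝ) (n : Measure (ℝ × ℝ))
    (f : ℝ → ℝ≥0∞) : Prop :=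
  ∫⁻ ω, expNeg (∫⁻ x, f x ∂κ ω) ∂P =
    expNeg (∫⁻ p, (1 - expNeg (ENNReal.ofReal p.2 * f p.1)) ∂n)

variable {P : Measure Ω} [IsProbabilityMeasure P] {κ : Ω → Measure ℝ} {n : Measure (ℝ × ℝ)}

lemma lintegral_one_sub_expNeg_mul_natCast_ne_top
    (hn : ∫⁻ p, (1 - expNeg (ENNReal.ofReal p.2)) ∂n ≠ ∞) (N : ℕ) :
    ∫⁻ p, (1 - expNeg (ENNReal.ofReal p.2 * N)) ∂n ≠ ∞ := by
  refine ((lintegral_mono fun p => one_sub_expNeg_mul_natCast_le _ N).trans_lt ?_).ne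
  rw [lintegral_const_mul _ (by fun_prop)]
  exact ENNReal.mul_lt_top (ENNReal.natCast_lt_top N) hn.lt_top

lemma tendsto_lintegral_expNeg {a : ℕ → Ω → ℝ≥0∞} {b : Ω → ℝ≥0∞}
    (ha : ∀ i, AEMeasurable (a i) P)
    (hab : ∀ᵐ ω ∂P, Tendsto (fun i => a i ω) atTop (𝓝 (b ω))) :
    Tendsto (fun i => ∫⁻ ω, expNeg (a i ω) ∂P) atTop (𝓝 (∫⁻ ω, expNeg (b ω) ∂P)) := by
  refine tendsto_lintegral_of_dominated_convergence' (fun _ => 1)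
    (fun i => measurable_expNeg.comp_aemeasurable (ha i))
    (fun i => Eventually.of_forall fun ω => expNeg_le_one _) (by simp) ?_
  filter_upwards [hab] with ω hω
  exact (continuous_expNeg.tendsto _).comp hω

/-- Dominated convergence on both sides: the constant `N` is integrable for the finite measure `κ
ω`, and `1 - exp(-N v)` is integrable for `n`. -/
lemma HasPoissonLaplace.of_tendsto [∀ ω, IsFiniteMeasure (κ ω)] (hκ : Measurable κ)
    (hn : ∫⁻ p, (1 - expNeg (ENNReal.ofReal p.2)) ∂n ≠ ∞)
    {f : ℕ → ℝ → ℝ≥0∞} {g : ℝ → ℝ≥0∞} (hf : ∀ i, Measurable (f i)) {N : ℕ}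
    (hfN : ∀ i x, f i x ≤ N)
    (hκg : ∀ᵐ ω ∂P, ∀ᵐ x ∂κ ω, Tendsto (fun i => f i x) atTop (𝓝 (g x)))
    (hng : ∀ᵐ p ∂n, Tendsto (fun i => f i p.1) atTop (𝓝 (g p.1)))
    (h : ∀ i, HasPoissonLaplace P κ n (f i)) : HasPoissonLaplace P κ n g := by
  have hL : Tendsto (fun i => ∫⁻ ω, expNeg (∫⁻ x, f i x ∂κ ω) ∂P) atTop
      (𝓝 (∫⁻ ω, expNeg (∫⁻ x, g x ∂κ ω) ∂P)) := by
    refine tendsto_lintegral_expNeg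
      (fun i => ((Measure.measurable_lintegral (hf i)).comp hκ).aemeasurable) ?_
    filter_upwards [hκg] with ω hω
    refine tendsto_lintegral_of_dominated_convergence (fun _ => N) hf
      (fun i => Eventually.of_forall (hfN i)) ?_ hω
    simpa using ENNReal.mul_ne_top (ENNReal.natCast_ne_top N) (measure_ne_top _ _)
  have hR : Tendsto (fun i => ∫⁻ p, (1 - expNeg (ENNReal.ofReal p.2 * f i p.1)) ∂n) atTop
      (𝓝 (∫⁻ p, (1 - expNeg (ENNReal.ofReal p.2 * g p.1)) ∂n)) := by
    refine tendsto_lintegral_of_dominated_convergence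
      (fun p => 1 - expNeg (ENNReal.ofReal p.2 * N)) (fun i => ?_) (fun i => ?_)
      (lintegral_one_sub_expNeg_mul_natCast_ne_top hn N) ?_
    · have := hf i
      fun_prop
    · exact Eventually.of_forall fun p =>
        tsub_le_tsub_left (antitone_expNeg (mul_le_mul_right (hfN i p.1) _)) 1
    · filter_upwards [hng] with p hp
      refine ENNReal.Tendsto.sub tendsto_const_nhds ((continuous_expNeg.tendsto _).comp
        (ENNReal.Tendsto.const_mul hp (Or.inr ENNReal.ofReal_ne_top))) (Or.inl ENNReal.one_ne_top)
  refine tendsto_nhds_unique hL ?_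
  simp_rw [HasPoissonLaplace] at h
  simp_rw [h]
  exact (continuous_expNeg.tendsto _).comp hR

/-- A finite measure that controls the null sets of almost every `κ ω` and of the first marginal
of `n`. -/
lemma exists_isFiniteMeasure_forall_ae [∀ ω, IsFiniteMeasure (κ ω)] (hκ : Measurable κ)
    (hn : ∫⁻ p, (1 - expNeg (ENNReal.ofReal p.2)) ∂n ≠ ∞) (hpos : ∀ᵐ p ∂n, 0 < p.2) :
    ∃ m : Measure ℝ, IsFiniteMeasure m ∧ ∀ q : ℝ → Prop, (∀ᵐ x ∂m, q x) →
      (∀ᵐ ω ∂P, ∀ᵐ x ∂κ ω, q x) ∧ ∀ᵐ p ∂n, q p.1 := by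
  have hκu : Measurable fun ω => κ ω univ := (Measure.measurable_coe .univ).comp hκ
  -- The mass of `κ ω` need not have finite mean; this positive weight makes the mean finite without
  -- changing null sets.
  set w : Ω → ℝ≥0∞ := fun ω => (1 + κ ω univ)⁻¹ with hw
  have hwm : Measurable w := (hκu.const_add 1).inv
  -- This density is positive for `v > 0` and has finite `n`-integral.
  set d : ℝ × ℝ → ℝ≥0∞ := fun p => 1 - expNeg (ENNReal.ofReal p.2) with hd
  have hdm : Measurable d := by fun_prop
  have h1 : IsFiniteMeasure ((P.withDensity w).bind κ) := by
    refine ⟨?_⟩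
    rw [Measure.bind_apply .univ hκ.aemeasurable, lintegral_withDensity_eq_lintegral_mul _ hwm hκu]
    refine (lintegral_mono (g := fun _ => 1) fun ω => ?_).trans_lt (by simp)
    simp only [Pi.mul_apply, hw]
    calc (1 + κ ω univ)⁻¹ * κ ω univ ≤ (1 + κ ω univ)⁻¹ * (1 + κ ω univ) := by
          gcongr; exact le_add_self
      _ ≤ 1 := ENNReal.inv_mul_le_one _
  have h2 : IsFiniteMeasure ((n.withDensity d).map Prod.fst) := by
    have : IsFiniteMeasure (n.withDensity d) := isFiniteMeasure_withDensity hn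
    infer_instance
  refine ⟨(P.withDensity w).bind κ + (n.withDensity d).map Prod.fst, inferInstance,
    fun q hq => ?_⟩
  rw [ae_add_measure_iff] at hq
  constructor
  · have := Measure.ae_ae_of_ae_bind hκ.aemeasurable hq.1
    refine (withDensity_absolutelyContinuous' hwm.aemeasurable ?_).ae_le this
    filter_upwards with ω
    simp [hw, measure_ne_top]
  · have := ae_of_ae_map measurable_fst.aemeasurable hq.2
    rw [ae_withDensity_iff hdm] at this
    filter_upwards [this, hpos] with p hp hp0
    refine hp ?_
    have : expNeg (ENNReal.ofReal p.2) < 1 := by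
      rw [expNeg_ofReal hp0.le]
      simpa using hp0
    simpa [hd, tsub_eq_zero_iff_le] using this

/-- Step functions with values `c j` on `(x j, x (j + 1)]`. -/
noncomputable def stepFun (x : ℕ → ℝ) (c : ℕ → ℝ≥0∞) (N : ℕ) (y : ℝ) : ℝ≥0∞ :=
  ∑ j ∈ Finset.range N, (Ioc (x j) (x (j + 1))).indicator (fun _ => c j) y

lemma measurable_stepFun (x : ℕ → ℝ) (c : ℕ → ℝ≥0∞) (N : ℕ) : Measurable (stepFun x c N) :=
  Finset.measurable_fun_sum _ fun _ _ => measurable_const.indicator measurableSet_Ioc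

lemma stepFun_eq {x : ℕ → ℝ} (hx : Monotone x) (c : ℕ → ℝ≥0∞) {N j : ℕ} (hj : j < N) {y : ℝ}
    (hy : y ∈ Ioc (x j) (x (j + 1))) : stepFun x c N y = c j := by
  rw [stepFun, Finset.sum_eq_single j]
  · simp [hy.1, hy.2]
  · intro i _ hij
    exact indicator_of_notMem
      (fun hi => (hx.pairwise_disjoint_on_Ioc_succ hij).le_bot ⟨hi, hy⟩) _
  · simp [hj]

lemma stepFun_eq_zero {x : ℕ → ℝ} {c : ℕ → ℝ≥0∞} {N : ℕ} {y : ℝ}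
    (hy : ∀ j < N, y ∉ Ioc (x j) (x (j + 1))) : stepFun x c N y = 0 :=
  Finset.sum_eq_zero fun j hj => indicator_of_notMem (hy j (Finset.mem_range.1 hj)) _

/-- At most one summand is nonzero at each point, so `φ` acts on the coefficients alone. -/
lemma map_stepFun {x : ℕ → ℝ} (hx : Monotone x) (c : ℕ → ℝ≥0∞) (N : ℕ) {φ : ℝ≥0∞ → ℝ≥0∞}
    (hφ : φ 0 = 0) (y : ℝ) : φ (stepFun x c N y) = stepFun x (φ ∘ c) N y := by
  by_cases h : ∃ j < N, y ∈ Ioc (x j) (x (j + 1))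
  · obtain ⟨j, hj, hy⟩ := h
    rw [stepFun_eq hx c hj hy, stepFun_eq hx _ hj hy, Function.comp_apply]
  · push Not at h
    rw [stepFun_eq_zero h, stepFun_eq_zero h, hφ]

lemma HasPoissonLaplace.of_continuous [∀ ω, IsFiniteMeasure (κ ω)] (hκ : Measurable κ)
    (hn : ∫⁻ p, (1 - expNeg (ENNReal.ofReal p.2)) ∂n ≠ ∞)
    (hstep : ∀ x : ℕ → ℝ, Monotone x → ∀ c : ℕ → ℝ≥0∞, (∀ j, c j ≠ ∞) → ∀ N,
      HasPoissonLaplace P κ n (stepFun x c N))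
    {g : ℝ → ℝ≥0∞} (hg : Continuous g) {N : ℕ} (hgN : ∀ x, g x ≤ N) :
    HasPoissonLaplace P κ n g := by
  -- A grid of mesh `1 / (i + 1)` starting at `-i`; its first `2 * i * (i + 1)` cells fill `(-i,
  -- i]`.
  set x : ℕ → ℕ → ℝ := fun i j => -i + j / (i + 1) with hx
  have hxm : ∀ i, Monotone (x i) := fun i a b hab => by
    simp only [hx]
    gcongr
  set f : ℕ → ℝ → ℝ≥0∞ := fun i => stepFun (x i) (fun j => g (x i (j + 1))) (2 * i * (i + 1))
    with hf
  have hlim : ∀ y, Tendsto (fun i => f i y) atTop (𝓝 (g y)) := by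
    intro y
    have hj : ∀ i : ℕ, |y| < i → ∃ z, f i y = g z ∧ |z - y| ≤ 1 / ((i : ℝ) + 1) := by
      intro i hi
      have hi1 : (0 : ℝ) < i + 1 := by positivity
      obtain ⟨h1, h2⟩ := abs_lt.1 hi
      have hpos : 0 < (y + i) * (i + 1) := mul_pos (by linarith) hi1
      -- Cells are open on the left and closed on the right, so the ceiling locates the cell of `y`.
      obtain ⟨j, hjc⟩ : ∃ j, ⌈(y + i) * (i + 1)⌉₊ = j + 1 :=
        Nat.exists_eq_succ_of_ne_zero (Nat.ceil_pos.2 hpos).ne'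
      have hle : (y + i) * (i + 1) ≤ j + 1 := by
        have := Nat.le_ceil ((y + i) * ((i : ℝ) + 1))
        rw [hjc] at this
        exact_mod_cast this
      have hlt : (j : ℝ) < (y + i) * (i + 1) := by
        have := Nat.ceil_lt_add_one hpos.le
        rw [hjc] at this
        push_cast at this
        linarith
      have hjN : j < 2 * i * (i + 1) := by
        have : (j : ℝ) < 2 * i * (i + 1) := hlt.trans_le (by nlinarith)
        exact_mod_cast this
      have hl : x i j < y := by
        have := (div_lt_iff₀ hi1).2 hlt
        simp only [hx]
        linarith
      have hu : y ≤ x i (j + 1) := by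
        have := (le_div_iff₀ hi1).2 hle
        simp only [hx]
        push_cast
        linarith
      have hd : x i (j + 1) = x i j + 1 / ((i : ℝ) + 1) := by
        simp only [hx]
        push_cast
        ring
      refine ⟨x i (j + 1), stepFun_eq (hxm i) _ hjN ⟨hl, hu⟩, ?_⟩
      rw [abs_of_nonneg (by linarith)]
      linarith
    have hev : ∀ᶠ i : ℕ in atTop, |y| < i :=
      tendsto_natCast_atTop_atTop.eventually_gt_atTop |y|
    choose! z hz1 hz2 using hj
    have hzy : Tendsto z atTop (𝓝 y) := by
      rw [tendsto_iff_dist_tendsto_zero]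
      refine squeeze_zero' (Eventually.of_forall fun _ => dist_nonneg) ?_
        tendsto_one_div_add_atTop_nhds_zero_nat
      filter_upwards [hev] with i hi using hz2 i hi
    refine ((hg.tendsto y).comp hzy).congr' ?_
    filter_upwards [hev] with i hi using (hz1 i hi).symm
  refine HasPoissonLaplace.of_tendsto hκ hn (f := f) (N := N)
    (fun i => measurable_stepFun _ _ _) (fun i y => ?_)
    (Eventually.of_forall fun ω => Eventually.of_forall hlim)
    (Eventually.of_forall fun p => hlim p.1)
    fun i => hstep _ (hxm i) _ (fun j => ne_top_of_le_ne_top (ENNReal.natCast_ne_top N) (hgN _)) _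
  by_cases h : ∃ j < 2 * i * (i + 1), y ∈ Ioc (x i j) (x i (j + 1))
  · obtain ⟨j, hj, hy⟩ := h
    exact (stepFun_eq (hxm i) _ hj hy).trans_le (hgN _)
  · push Not at h
    exact (stepFun_eq_zero h).trans_le zero_le

/-- Bounded continuous functions are dense in `L¹(m)`, where `m` controls both kinds of null sets. A
subsequence converges `m`-a.e., and clipping it to `[0, N]` keeps it dominated. -/
lemma HasPoissonLaplace.of_bounded [∀ ω, IsFiniteMeasure (κ ω)] (hκ : Measurable κ)
    (hn : ∫⁻ p, (1 - expNeg (ENNReal.ofReal p.2)) ∂n ≠ ∞) (hpos : ∀ᵐ p ∂n, 0 < p.2)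
    (hstep : ∀ x : ℕ → ℝ, Monotone x → ∀ c : ℕ → ℝ≥0∞, (∀ j, c j ≠ ∞) → ∀ N,
      HasPoissonLaplace P κ n (stepFun x c N))
    {g : ℝ → ℝ≥0∞} (hg : Measurable g) {N : ℕ} (hgN : ∀ x, g x ≤ N) :
    HasPoissonLaplace P κ n g := by
  obtain ⟨m, hm, hmq⟩ := exists_isFiniteMeasure_forall_ae (P := P) hκ hn hpos
  have hgt : ∀ x, g x ≠ ∞ := fun x => ne_top_of_le_ne_top (ENNReal.natCast_ne_top N) (hgN x)
  have hgr : ∀ x, (g x).toReal ≤ N := fun x => by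
    simpa using ENNReal.toReal_mono (ENNReal.natCast_ne_top N) (hgN x)
  have hmem : MemLp (fun x => (g x).toReal) 1 m := by
    refine MemLp.of_bound hg.ennreal_toReal.aestronglyMeasurable N (Eventually.of_forall fun x => ?_)
    rw [Real.norm_of_nonneg ENNReal.toReal_nonneg]
    exact hgr x
  have hex : ∀ i : ℕ, ∃ h : BoundedContinuousFunction ℝ ℝ,
      eLpNorm ((fun x => (g x).toReal) - ⇑h) 1 m ≤ ((i : ℝ≥0∞) + 1)⁻¹ := fun i => by
    obtain ⟨h, hh, -⟩ := hmem.exists_boundedContinuous_eLpNorm_sub_le ENNReal.one_ne_top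
      (ε := ((i : ℝ≥0∞) + 1)⁻¹) (by simp)
    exact ⟨h, hh⟩
  choose h hh using hex
  have hLp : Tendsto (fun i => eLpNorm (⇑(h i) - fun x => (g x).toReal) 1 m) atTop (𝓝 0) := by
    refine tendsto_of_tendsto_of_tendsto_of_le_of_le tendsto_const_nhds
      ((tendsto_add_atTop_iff_nat 1).2 ENNReal.tendsto_inv_nat_nhds_zero) (fun _ => zero_le)
      fun i => ?_
    rw [eLpNorm_sub_comm]
    simpa using hh i
  obtain ⟨ns, -, hns⟩ := (tendstoInMeasure_of_tendsto_eLpNorm one_ne_zero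
    (fun i => (h i).continuous.aestronglyMeasurable)
    hg.ennreal_toReal.aestronglyMeasurable hLp).exists_seq_tendsto_ae
  have hae : ∀ᵐ x ∂m, Tendsto (fun i => ENNReal.ofReal (min (h (ns i) x) N)) atTop (𝓝 (g x)) := by
    filter_upwards [hns] with x hx
    have := ENNReal.tendsto_ofReal (hx.min (tendsto_const_nhds (x := (N : ℝ))))
    rwa [min_eq_left (hgr x), ENNReal.ofReal_toReal (hgt x)] at this
  have hbd : ∀ i x, ENNReal.ofReal (min (h (ns i) x) N) ≤ N := fun i x => by
    simp
  have hcont : ∀ i, Continuous fun x => ENNReal.ofReal (min (h (ns i) x) N) := fun i =>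
    ENNReal.continuous_ofReal.comp ((h (ns i)).continuous.min continuous_const)
  exact HasPoissonLaplace.of_tendsto hκ hn (fun i => (hcont i).measurable) hbd (hmq _ hae).1
    (hmq _ hae).2 fun i => HasPoissonLaplace.of_continuous hκ hn hstep (hcont i) (hbd i)

/-- The truncations `min g N` increase to `g`, so monotone convergence handles the exponents even
where they are infinite. -/
lemma HasPoissonLaplace.of_measurable [∀ ω, IsFiniteMeasure (κ ω)] (hκ : Measurable κ)
    (hn : ∫⁻ p, (1 - expNeg (ENNReal.ofReal p.2)) ∂n ≠ ∞) (hpos : ∀ᵐ p ∂n, 0 < p.2)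
    (hstep : ∀ x : ℕ → ℝ, Monotone x → ∀ c : ℕ → ℝ≥0∞, (∀ j, c j ≠ ∞) → ∀ N,
      HasPoissonLaplace P κ n (stepFun x c N))
    {g : ℝ → ℝ≥0∞} (hg : Measurable g) : HasPoissonLaplace P κ n g := by
  have hmono : ∀ x, Monotone fun N : ℕ => min (g x) (N : ℝ≥0∞) := fun x a b hab =>
    min_le_min le_rfl (Nat.cast_le.2 hab)
  have hlim : ∀ x, Tendsto (fun N : ℕ => min (g x) (N : ℝ≥0∞)) atTop (𝓝 (g x)) := fun x => by
    have := (tendsto_const_nhds (x := g x)).min ENNReal.tendsto_nat_nhds_top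
    rwa [min_eq_left le_top] at this
  have hgm : ∀ N : ℕ, Measurable fun x => min (g x) (N : ℝ≥0∞) := fun N => hg.min measurable_const
  have hL : Tendsto (fun N : ℕ => ∫⁻ ω, expNeg (∫⁻ x, min (g x) (N : ℝ≥0∞) ∂κ ω) ∂P) atTop
      (𝓝 (∫⁻ ω, expNeg (∫⁻ x, g x ∂κ ω) ∂P)) := by
    refine tendsto_lintegral_expNeg
      (fun i => ((Measure.measurable_lintegral (hgm i)).comp hκ).aemeasurable)
      (Eventually.of_forall fun ω => ?_)
    exact lintegral_tendsto_of_tendsto_of_monotone (fun i => (hgm i).aemeasurable)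
      (Eventually.of_forall hmono) (Eventually.of_forall hlim)
  have hR : Tendsto
      (fun N : ℕ => ∫⁻ p, (1 - expNeg (ENNReal.ofReal p.2 * min (g p.1) (N : ℝ≥0∞))) ∂n) atTop
      (𝓝 (∫⁻ p, (1 - expNeg (ENNReal.ofReal p.2 * g p.1)) ∂n)) := by
    refine lintegral_tendsto_of_tendsto_of_monotone (fun i => ?_)
      (Eventually.of_forall fun p a b hab => ?_) (Eventually.of_forall fun p => ?_)
    · have := hgm i
      exact Measurable.aemeasurable (by fun_prop)
    · exact tsub_le_tsub_left (antitone_expNeg (mul_le_mul_right (hmono p.1 hab) _)) 1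
    · exact ENNReal.Tendsto.sub tendsto_const_nhds ((continuous_expNeg.tendsto _).comp
        (ENNReal.Tendsto.const_mul (hlim p.1) (Or.inr ENNReal.ofReal_ne_top)))
        (Or.inl ENNReal.one_ne_top)
  refine tendsto_nhds_unique hL ?_
  have h : ∀ N : ℕ, HasPoissonLaplace P κ n fun x => min (g x) (N : ℝ≥0∞) := fun N =>
    HasPoissonLaplace.of_bounded hκ hn hpos hstep (hgm N) (N := N) fun x => min_le_right _ _
  simp_rw [HasPoissonLaplace] at h
  simp_rw [h]
  exact (continuous_expNeg.tendsto _).comp hR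

end LaplaceFunctional

/-! ### Stieltjes measures of time-changed paths -/

section Paths

lemma monotone_distFun (α : Measure ℝ) [IsFiniteMeasure α] : Monotone (distFun α) :=
  fun _ _ h => ENNReal.toNNReal_mono (measure_ne_top _ _) (measure_mono (Iic_subset_Iic.2 h))

lemma distFun_le (α : Measure ℝ) [IsFiniteMeasure α] (x : ℝ) : distFun α x ≤ (α univ).toNNReal :=
  ENNReal.toNNReal_mono (measure_ne_top _ _) (measure_mono (subset_univ _))

lemma tendsto_distFun_atBot (α : Measure ℝ) [IsFiniteMeasure α] :
    Tendsto (distFun α) atBot (𝓝 0) := by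
  have := tendsto_measure_iInter_atBot (μ := α) (s := fun x : ℝ => Iic x)
    (fun x => measurableSet_Iic.nullMeasurableSet) (fun _ _ h => Iic_subset_Iic.2 h)
    ⟨0, measure_ne_top _ _⟩
  have h0 : ⋂ x : ℝ, Iic x = ∅ := by
    ext y
    simpa using ⟨y - 1, by linarith⟩
  rw [h0, measure_empty] at this
  exact (ENNReal.tendsto_toNNReal ENNReal.zero_ne_top).comp this

lemma continuousWithinAt_distFun (α : Measure ℝ) [IsFiniteMeasure α] (x : ℝ) :
    ContinuousWithinAt (distFun α) (Ici x) x := by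
  rw [← continuousWithinAt_Ioi_iff_Ici]
  have := tendsto_measure_biInter_gt (μ := α) (s := fun y : ℝ => Iic y) (a := x)
    (fun y _ => measurableSet_Iic.nullMeasurableSet) (fun _ _ _ h => Iic_subset_Iic.2 h)
    ⟨x + 1, by linarith, measure_ne_top _ _⟩
  have h0 : ⋂ y > x, Iic y = Iic x := by
    ext z
    simp only [mem_iInter, mem_Iic]
    exact ⟨fun h => le_of_forall_gt_imp_ge_of_dense h, fun h y hy => h.trans (le_of_lt hy)⟩
  rw [h0] at this
  exact (ENNReal.tendsto_toNNReal (measure_ne_top _ _)).comp this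

variable {l : ℝ≥0 → ℝ} (α : Measure ℝ) [IsFiniteMeasure α]

lemma continuousWithinAt_comp_distFun (hl : ∀ y, ContinuousWithinAt l (Ici y) y) (x : ℝ) :
    ContinuousWithinAt (fun x => l (distFun α x)) (Ici x) x :=
  (hl _).comp (continuousWithinAt_distFun α x) fun _ h => monotone_distFun α h

lemma stieltjes_eq {g : ℝ → ℝ} (hg : Monotone g) (hc : ∀ x, ContinuousWithinAt g (Ici x) x) :
    stieltjes g = (StieltjesFunction.mk g hg hc).measure := dif_pos ⟨hg, hc⟩

lemma stieltjes_Ioc {g : ℝ → ℝ} (hg : Monotone g) (hc : ∀ x, ContinuousWithinAt g (Ici x) x)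
    (a b : ℝ) : stieltjes g (Ioc a b) = ENNReal.ofReal (g b - g a) := by
  rw [stieltjes_eq hg hc, StieltjesFunction.measure_Ioc]

/-- Since `A → 0` at `-∞`, right continuity of `l` at `0` gives `l(A(x)) → l(0) = 0`. -/
lemma stieltjes_comp_distFun_Iic (h0 : l 0 = 0) (hm : Monotone l)
    (hl : ∀ y, ContinuousWithinAt l (Ici y) y) (x : ℝ) :
    stieltjes (fun x => l (distFun α x)) (Iic x) = ENNReal.ofReal (l (distFun α x)) := by
  have hmA : Monotone fun x => l (distFun α x) := hm.comp (monotone_distFun α)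
  rw [stieltjes_eq hmA (continuousWithinAt_comp_distFun α hl),
    StieltjesFunction.measure_Iic _ (l := 0), sub_zero]
  have h1 : Tendsto (distFun α) atBot (𝓝[Ici 0] 0) :=
    tendsto_nhdsWithin_iff.2 ⟨tendsto_distFun_atBot α, Eventually.of_forall fun x =>
      (zero_le : 0 ≤ distFun α x)⟩
  have h2 := (hl 0).tendsto.comp h1
  rwa [h0] at h2

lemma isFiniteMeasure_stieltjes_comp_distFun (h0 : l 0 = 0) (hm : Monotone l)
    (hl : ∀ y, ContinuousWithinAt l (Ici y) y) :
    IsFiniteMeasure (stieltjes fun x => l (distFun α x)) := by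
  refine ⟨(le_of_tendsto' (tendsto_measure_Iic_atTop _) fun x => ?_).trans_lt
    (ENNReal.ofReal_lt_top (r := l (α univ).toNNReal))⟩
  rw [stieltjes_comp_distFun_Iic α h0 hm hl]
  exact ENNReal.ofReal_le_ofReal (hm (distFun_le α x))

end Paths

/-! ### A measurable version of `dL_A` -/

section RandomMeasure

variable {Ω : Type*} [MeasurableSpace Ω] {P : Measure Ω} {L : ℝ≥0 → Ω → ℝ}

/-- The path properties hold only almost surely, so the measure is set to zero off a measurable set
of full probability. Measurability is then checked on the half-lines `Iic x`, a generating π-system.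
-/
lemma exists_measurable_version (hL : IsIncreasingAdditive L P) (α : Measure ℝ)
    [IsFiniteMeasure α] :
    ∃ κ : Ω → Measure ℝ, Measurable κ ∧ (∀ ω, IsFiniteMeasure (κ ω)) ∧
      ∀ᵐ ω ∂P, κ ω = stieltjes fun x => timeChange L α x ω := by
  classical
  obtain ⟨G, hG, hGm, hGP⟩ := (hL.zero.and hL.paths).exists_measurable_mem
  set κ : Ω → Measure ℝ := fun ω =>
    if ω ∈ G then stieltjes fun x => L (distFun α x) ω else 0 with hκ
  have hfin : ∀ ω, IsFiniteMeasure (κ ω) := fun ω => by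
    by_cases hω : ω ∈ G
    · obtain ⟨h0, hm, hc⟩ := hGP ω hω
      simpa only [hκ, if_pos hω] using isFiniteMeasure_stieltjes_comp_distFun α h0 hm hc
    · simp only [hκ, if_neg hω]
      infer_instance
  have hIic : ∀ x, Measurable fun ω => κ ω (Iic x) := fun x => by
    have : (fun ω => κ ω (Iic x)) =
        G.indicator fun ω => ENNReal.ofReal (L (distFun α x) ω) := by
      ext ω
      by_cases hω : ω ∈ G
      · obtain ⟨h0, hm, hc⟩ := hGP ω hω
        simpa only [hκ, if_pos hω, indicator_of_mem hω] using
          stieltjes_comp_distFun_Iic α h0 hm hc x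
      · simp [hκ, hω]
    rw [this]
    exact (hL.measurable _).ennreal_ofReal.indicator hGm
  refine ⟨κ, ?_, hfin, ?_⟩
  · refine Measurable.measure_of_isPiSystem (borel_eq_generateFrom_Iic ℝ ▸ BorelSpace.measurable_eq)
      isPiSystem_Iic ?_ ?_
    · rintro _ ⟨x, rfl⟩
      exact hIic x
    · exact measurable_of_tendsto_metrizable (fun i : ℕ => hIic i) (tendsto_pi_nhds.2 fun ω =>
        (tendsto_measure_Iic_atTop (κ ω)).comp tendsto_natCast_atTop_atTop)
  · filter_upwards [hG] with ω hω
    simp only [hκ, if_pos hω, timeChange]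

end RandomMeasure

/-! ### The Laplace functional of `dL_A` -/

section Intensity

variable {Ω : Type*} [MeasurableSpace Ω] {P : Measure Ω} {L : ℝ≥0 → Ω → ℝ}
  {ν : ℝ≥0 → Measure ℝ} {α : Measure ℝ} {νt : Measure (ℝ × ℝ)}

lemma IsIncreasingAdditive.nonneg (hL : IsIncreasingAdditive L P) (y : ℝ≥0) :
    ∀ᵐ ω ∂P, 0 ≤ L y ω := by
  filter_upwards [hL.zero, hL.paths] with ω h0 h
  simpa [h0] using h.1 (zero_le (a := y))

lemma one_sub_expNeg_ofReal_le {v : ℝ} (hv : 0 ≤ v) :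
    1 - expNeg (ENNReal.ofReal v) ≤ ENNReal.ofReal (min 1 v) := by
  rw [one_sub_expNeg_ofReal hv]
  refine ENNReal.ofReal_le_ofReal (le_min ?_ ?_)
  · linarith [Real.exp_pos (-v)]
  · linarith [Real.add_one_le_exp (-v)]

lemma HasLevyMeasures.lintegral_ne_top (hν : HasLevyMeasures L ν P) (y : ℝ≥0) {c : ℝ≥0∞}
    (hc : c ≠ ∞) : ∫⁻ v in Ioi (0 : ℝ), (1 - expNeg (ENNReal.ofReal v * c)) ∂ν y ≠ ∞ := by
  obtain ⟨N, hN⟩ := ENNReal.exists_nat_gt hc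
  refine ne_top_of_le_ne_top
    (ENNReal.mul_ne_top (ENNReal.natCast_ne_top N) (hν.integrable y).ne) ?_
  rw [← lintegral_const_mul _ (by fun_prop)]
  refine setLIntegral_mono (by fun_prop) fun v hv => ?_
  calc 1 - expNeg (ENNReal.ofReal v * c) ≤ 1 - expNeg (ENNReal.ofReal v * N) :=
        tsub_le_tsub_left (antitone_expNeg (mul_le_mul_right hN.le _)) 1
    _ ≤ N * (1 - expNeg (ENNReal.ofReal v)) := one_sub_expNeg_mul_natCast_le _ _
    _ ≤ _ := by
      gcongr
      exact one_sub_expNeg_ofReal_le (le_of_lt hv)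

lemma IsPoissonIntensity.setLIntegral (hνt : IsPoissonIntensity νt ν α) (x : ℝ) {φ : ℝ → ℝ≥0∞}
    (hφ : Measurable φ) :
    ∫⁻ p in Iic x ×ˢ Ioi 0, φ p.2 ∂νt = ∫⁻ v in Ioi 0, φ v ∂ν (distFun α x) := by
  have : (νt.restrict (Iic x ×ˢ Ioi 0)).map Prod.snd = (ν (distFun α x)).restrict (Ioi 0) := by
    ext C hC
    rw [Measure.map_apply measurable_snd hC, Measure.restrict_apply (measurable_snd hC),
      Measure.restrict_apply hC, ← hνt x _ (hC.inter measurableSet_Ioi) inter_subset_right]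
    congr 1
    ext p
    simp
    tauto
  rw [← this, lintegral_map hφ measurable_snd]

variable [IsProbabilityMeasure P]

lemma HasLevyMeasures.lintegral_expNeg (hL : IsIncreasingAdditive L P)
    (hν : HasLevyMeasures L ν P) (y : ℝ≥0) {c : ℝ≥0∞} (hc : c ≠ ∞) :
    ∫⁻ ω, expNeg (c * ENNReal.ofReal (L y ω)) ∂P =
      expNeg (∫⁻ v in Ioi (0 : ℝ), (1 - expNeg (ENNReal.ofReal v * c)) ∂ν y) := by
  have hfin := hν.lintegral_ne_top y hc
  lift c to ℝ≥0 using hc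
  have hl : ∫⁻ ω, expNeg (c * ENNReal.ofReal (L y ω)) ∂P =
      ENNReal.ofReal (∫ ω, Real.exp (-(c * L y ω)) ∂P) := by
    have hm : Measurable fun ω => Real.exp (-(c * L y ω)) := by
      have := hL.measurable y
      fun_prop
    rw [ofReal_integral_eq_lintegral_ofReal]
    · refine lintegral_congr_ae ?_
      filter_upwards [hL.nonneg y] with ω hω
      rw [← ENNReal.ofReal_coe_nnreal, ← ENNReal.ofReal_mul c.coe_nonneg,
        expNeg_ofReal (by positivity)]
    · refine Integrable.of_bound hm.aestronglyMeasurable 1 ?_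
      filter_upwards [hL.nonneg y] with ω hω
      rw [Real.norm_of_nonneg (Real.exp_nonneg _), Real.exp_le_one_iff]
      have := mul_nonneg c.coe_nonneg hω
      linarith
    · exact Eventually.of_forall fun ω => Real.exp_nonneg _
  have hr : ∀ v ∈ Ioi (0 : ℝ), 1 - expNeg (ENNReal.ofReal v * c) =
      ENNReal.ofReal (1 - Real.exp (-(c * v))) := fun v hv => by
    rw [← ENNReal.ofReal_coe_nnreal, ← ENNReal.ofReal_mul (le_of_lt hv), mul_comm,
      one_sub_expNeg_ofReal (mul_nonneg c.coe_nonneg (le_of_lt hv))]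
  have hpos : ∀ v ∈ Ioi (0 : ℝ), 0 ≤ 1 - Real.exp (-(c * v)) := fun v hv => by
    rw [sub_nonneg, Real.exp_le_one_iff]
    have := mul_nonneg c.coe_nonneg (le_of_lt hv)
    linarith
  -- Finiteness is needed to pass from the Bochner integral in `laplace` to the `[0, ∞]`-valued one.
  rw [setLIntegral_congr_fun measurableSet_Ioi hr] at hfin ⊢
  rw [hl, hν.laplace y c c.coe_nonneg, ← expNeg_ofReal (setIntegral_nonneg measurableSet_Ioi hpos),
    ofReal_integral_eq_lintegral_ofReal]
  · refine ⟨(by fun_prop : Measurable fun v : ℝ => 1 - Real.exp (-(c * v))).aestronglyMeasurable, ?_⟩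
    rw [hasFiniteIntegral_iff_ofReal]
    · exact hfin.lt_top
    · exact (ae_restrict_mem measurableSet_Ioi).mono hpos
  · exact (ae_restrict_mem measurableSet_Ioi).mono hpos

variable [IsFiniteMeasure α]

/-- Uniform bound over the strips `Iic m`: paths are monotone, so `L(A(m)) ≤ L(α(ℝ))`, and comparing
Laplace transforms bounds the exponent at `A(m)` by the finite one at `α(ℝ)`. -/
lemma lintegral_poissonIntensity_ne_top (hL : IsIncreasingAdditive L P)
    (hν : HasLevyMeasures L ν P) (hνt : IsPoissonIntensity νt ν α) :
    ∫⁻ p in univ ×ˢ Ioi (0 : ℝ), (1 - expNeg (ENNReal.ofReal p.2)) ∂νt ≠ ∞ := by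
  set d : ℝ × ℝ → ℝ≥0∞ := fun p => 1 - expNeg (ENNReal.ofReal p.2)
  have hU : (univ ×ˢ Ioi (0 : ℝ) : Set (ℝ × ℝ)) = ⋃ m : ℕ, Iic (m : ℝ) ×ˢ Ioi 0 := by
    ext p
    simpa using fun _ => exists_nat_ge p.1
  have hmono : Monotone fun m : ℕ => (Iic (m : ℝ) ×ˢ Ioi 0 : Set (ℝ × ℝ)) := fun a b hab =>
    prod_mono (Iic_subset_Iic.2 (Nat.cast_le.2 hab)) le_rfl
  have hlap := hν.lintegral_expNeg hL (c := 1) (y := (α univ).toNNReal) (by simp)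
  simp only [mul_one, one_mul] at hlap
  refine ne_top_of_le_ne_top (hν.lintegral_ne_top (α univ).toNNReal ENNReal.one_ne_top) ?_
  rw [hU, setLIntegral_iUnion_of_directed _ hmono.directed_le]
  refine iSup_le fun m => ?_
  rw [hνt.setLIntegral (φ := fun v => 1 - expNeg (ENNReal.ofReal v)) m (by fun_prop),
    ← expNeg_le_expNeg_iff]
  have hlm := hν.lintegral_expNeg hL (c := 1) (y := distFun α m) (by simp)
  simp only [mul_one, one_mul] at hlm ⊢
  rw [← hlap, ← hlm]
  refine lintegral_mono_ae ?_
  filter_upwards [hL.paths] with ω hω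
  exact antitone_expNeg (ENNReal.ofReal_le_ofReal (hω.1 (distFun_le α m)))

/-- Independence factors the transform at `A(b)` through the one at `A(a)`; additivity of `νt` over
`Iic a ∪ Ioc a b` factors the right side likewise. The common factor is cancelled. -/
lemma lintegral_expNeg_increment (hL : IsIncreasingAdditive L P) (hν : HasLevyMeasures L ν P)
    (hνt : IsPoissonIntensity νt ν α) {a b : ℝ} (hab : a ≤ b) {c : ℝ≥0∞} (hc : c ≠ ∞) :
    ∫⁻ ω, expNeg (c * ENNReal.ofReal (L (distFun α b) ω - L (distFun α a) ω)) ∂P =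
      expNeg (∫⁻ p in Ioc a b ×ˢ Ioi 0, (1 - expNeg (ENNReal.ofReal p.2 * c)) ∂νt) := by
  set φ : ℝ → ℝ≥0∞ := fun v => 1 - expNeg (ENNReal.ofReal v * c) with hφ
  have hφm : Measurable φ := by fun_prop
  have hA := monotone_distFun α hab
  have hind := hL.indep.indepFun_eval_sub (r := 0) (zero_le (a := distFun α a)) hA hL.zero
  have hψ : Measurable fun u : ℝ => expNeg (c * ENNReal.ofReal u) := by fun_prop
  have hprod := lintegral_mul_eq_lintegral_mul_lintegral_of_indepFun
    (hψ.comp (hL.measurable (distFun α a)))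
    (hψ.comp ((hL.measurable (distFun α b)).sub (hL.measurable (distFun α a))))
    (hind.comp hψ hψ)
  have hsum : ∫⁻ ω, expNeg (c * ENNReal.ofReal (L (distFun α b) ω)) ∂P =
      (∫⁻ ω, expNeg (c * ENNReal.ofReal (L (distFun α a) ω)) ∂P) *
        ∫⁻ ω, expNeg (c * ENNReal.ofReal (L (distFun α b) ω - L (distFun α a) ω)) ∂P := by
    refine Eq.trans (lintegral_congr_ae ?_) hprod
    filter_upwards [hL.nonneg (distFun α a), hL.paths] with ω h0 hω
    simp only [Pi.mul_apply, Function.comp_apply, Pi.sub_apply]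
    rw [← expNeg_add, ← mul_add, ← ENNReal.ofReal_add h0 (sub_nonneg.2 (hω.1 hA)),
      add_sub_cancel]
  have hfa := hν.lintegral_ne_top (distFun α a) hc
  rw [hν.lintegral_expNeg hL _ hc, hν.lintegral_expNeg hL _ hc, ← hνt.setLIntegral b hφm,
    ← Iic_union_Ioc_eq_Iic hab, union_prod, lintegral_union (measurableSet_Ioc.prod
      measurableSet_Ioi) (Disjoint.set_prod_left (Iic_disjoint_Ioc le_rfl) _ _),
    hνt.setLIntegral a hφm, expNeg_add] at hsum
  -- The cancelled factor is nonzero because its exponent is finite (`hfa`).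
  exact ((ENNReal.mul_right_inj (by rwa [Ne, expNeg_eq_zero_iff]) (expNeg_ne_top _)).1 hsum).symm

lemma hasPoissonLaplace_stepFun (hL : IsIncreasingAdditive L P) (hν : HasLevyMeasures L ν P)
    (hνt : IsPoissonIntensity νt ν α) {κ : Ω → Measure ℝ}
    (hκ : ∀ᵐ ω ∂P, κ ω = stieltjes fun x => timeChange L α x ω)
    {x : ℕ → ℝ} (hx : Monotone x) {c : ℕ → ℝ≥0∞} (hc : ∀ j, c j ≠ ∞) (N : ℕ) :
    HasPoissonLaplace P κ (νt.restrict (univ ×ˢ Ioi 0)) (stepFun x c N) := by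
  have hl : ∀ᵐ ω ∂P, expNeg (∫⁻ y, stepFun x c N y ∂κ ω) = ∏ j ∈ Finset.range N,
      expNeg (c j * ENNReal.ofReal (L (distFun α (x (j + 1))) ω - L (distFun α (x j)) ω)) := by
    filter_upwards [hκ, hL.paths] with ω h1 h2
    rw [h1, ← expNeg_sum]
    simp only [stepFun]
    rw [lintegral_finsetSum _ fun j _ => measurable_const.indicator measurableSet_Ioc]
    congr 1
    refine Finset.sum_congr rfl fun j _ => ?_
    rw [lintegral_indicator_const measurableSet_Ioc]
    congr 1
    exact stieltjes_Ioc (h2.1.comp (monotone_distFun α)) (continuousWithinAt_comp_distFun α h2.2) _ _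
  have hind := (hL.indep.nat ((monotone_distFun α).comp hx)).comp
    (fun j u => expNeg (c j * ENNReal.ofReal u)) (fun j => by fun_prop)
  have hr : ∫⁻ p in univ ×ˢ Ioi 0, (1 - expNeg (ENNReal.ofReal p.2 * stepFun x c N p.1)) ∂νt =
      ∑ j ∈ Finset.range N, ∫⁻ p in Ioc (x j) (x (j + 1)) ×ˢ Ioi 0,
        (1 - expNeg (ENNReal.ofReal p.2 * c j)) ∂νt := by
    have : ∀ p : ℝ × ℝ, 1 - expNeg (ENNReal.ofReal p.2 * stepFun x c N p.1) =
        ∑ j ∈ Finset.range N, (Ioc (x j) (x (j + 1)) ×ˢ univ).indicator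
          (fun p : ℝ × ℝ => 1 - expNeg (ENNReal.ofReal p.2 * c j)) p := fun p => by
      rw [map_stepFun hx c N (φ := fun u => 1 - expNeg (ENNReal.ofReal p.2 * u)) (by simp)]
      refine Finset.sum_congr rfl fun j _ => ?_
      simp [indicator_apply]
    simp_rw [this]
    rw [lintegral_finsetSum _ fun j _ => Measurable.indicator (by fun_prop)
      (measurableSet_Ioc.prod .univ)]
    refine Finset.sum_congr rfl fun j _ => ?_
    rw [setLIntegral_indicator (measurableSet_Ioc.prod .univ), prod_inter_prod, inter_univ,
      univ_inter]
  rw [HasPoissonLaplace, hr, expNeg_sum, lintegral_congr_ae hl]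
  refine (lintegral_prod_eq_prod_lintegral_of_indepFun (Finset.range N) _ hind fun j => ?_).trans
    (Finset.prod_congr rfl fun j _ => ?_)
  · have h1 := hL.measurable (distFun α (x (j + 1)))
    have h2 := hL.measurable (distFun α (x j))
    simp only [Function.comp_def]
    fun_prop
  · exact lintegral_expNeg_increment hL hν hνt (hx j.le_succ) (hc j)

/-- The Laplace functional of the random measure `dL_A`, at every measurable `f : ℝ → [0, ∞]`. -/
lemma hasPoissonLaplace (hL : IsIncreasingAdditive L P) (hν : HasLevyMeasures L ν P)
    (hνt : IsPoissonIntensity νt ν α) {κ : Ω → Measure ℝ} [∀ ω, IsFiniteMeasure (κ ω)]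
    (hκm : Measurable κ) (hκ : ∀ᵐ ω ∂P, κ ω = stieltjes fun x => timeChange L α x ω)
    {f : ℝ → ℝ≥0∞} (hf : Measurable f) :
    HasPoissonLaplace P κ (νt.restrict (univ ×ˢ Ioi 0)) f := by
  refine HasPoissonLaplace.of_measurable hκm (lintegral_poissonIntensity_ne_top hL hν hνt) ?_
    (fun x hx c hc N => hasPoissonLaplace_stepFun hL hν hνt hκ hx hc N) hf
  filter_upwards [ae_restrict_mem (MeasurableSet.univ.prod measurableSet_Ioi)] with p hp
  exact hp.2

end Intensity

/-! ### Integrals of the kernel against a fixed measure -/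

section Kernel

variable {k : ℝ → ℝ → ℝ≥0} {kbar : ℝ → ℝ≥0}

lemma CondI.le_kbar (hI : CondI k) (hkbar : ∀ x, Tendsto (fun t => k t x) atTop (𝓝 (kbar x)))
    (t x : ℝ) : k t x ≤ kbar x := (hI.mono x).ge_of_tendsto (hkbar x) t

lemma CondI.monotone_lintegral (hI : CondI k) (μ : Measure ℝ) :
    Monotone fun t => ∫⁻ x, (k t x : ℝ≥0∞) ∂μ := fun _ _ h =>
  lintegral_mono fun x => ENNReal.coe_le_coe.2 (hI.mono x h)

/-- The limit may be infinite, so monotone convergence is used, along the integers; monotonicity in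
`t` gives the full limit. -/
lemma tendsto_lintegral_kernel_atTop (hk : ∀ t, Measurable (k t)) (hI : CondI k)
    (hkbar : ∀ x, Tendsto (fun t => k t x) atTop (𝓝 (kbar x))) (μ : Measure ℝ) :
    Tendsto (fun t => ∫⁻ x, (k t x : ℝ≥0∞) ∂μ) atTop (𝓝 (∫⁻ x, (kbar x : ℝ≥0∞) ∂μ)) := by
  have h1 := tendsto_atTop_iSup (hI.monotone_lintegral μ)
  have h2 : Tendsto (fun i : ℕ => ∫⁻ x, (k i x : ℝ≥0∞) ∂μ) atTop
      (𝓝 (∫⁻ x, (kbar x : ℝ≥0∞) ∂μ)) := by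
    refine lintegral_tendsto_of_tendsto_of_monotone
      (fun i => (hk i).coe_nnreal_ennreal.aemeasurable)
      (Eventually.of_forall fun x a b hab => ?_) (Eventually.of_forall fun x => ?_)
    · exact ENNReal.coe_le_coe.2 (hI.mono x (Nat.cast_le.2 hab))
    · exact (ENNReal.tendsto_coe.2 (hkbar x)).comp tendsto_natCast_atTop_atTop
  rwa [tendsto_nhds_unique (h1.comp tendsto_natCast_atTop_atTop) h2] at h1

lemma isDF_lintegral_kernel (hk : ∀ t, Measurable (k t)) (hI : CondI k)
    (hkbar : ∀ x, Tendsto (fun t => k t x) atTop (𝓝 (kbar x))) {μ : Measure ℝ}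
    (hμ : ∫⁻ x, (kbar x : ℝ≥0∞) ∂μ ≠ ∞) :
    IsDF fun t => (∫⁻ x, (k t x : ℝ≥0∞) ∂μ).toReal := by
  have hle : ∀ t, ∫⁻ x, (k t x : ℝ≥0∞) ∂μ ≤ ∫⁻ x, (kbar x : ℝ≥0∞) ∂μ := fun t =>
    lintegral_mono fun x => ENNReal.coe_le_coe.2 (hI.le_kbar hkbar t x)
  -- One dominated convergence serves both right continuity and the limit at `-∞`.
  have hlim : ∀ (u : Filter ℝ) [u.IsCountablyGenerated] (g : ℝ → ℝ≥0),
      (∀ x, Tendsto (fun t => k t x) u (𝓝 (g x))) → ∫⁻ x, (g x : ℝ≥0∞) ∂μ ≠ ∞ →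
      Tendsto (fun t => (∫⁻ x, (k t x : ℝ≥0∞) ∂μ).toReal) u
        (𝓝 (∫⁻ x, (g x : ℝ≥0∞) ∂μ).toReal) := fun u _ g hg hgt =>
    (ENNReal.tendsto_toReal hgt).comp <| tendsto_lintegral_filter_of_dominated_convergence _
      (Eventually.of_forall fun t => (hk t).coe_nnreal_ennreal)
      (Eventually.of_forall fun t => Eventually.of_forall fun x =>
        ENNReal.coe_le_coe.2 (hI.le_kbar hkbar t x)) hμ
      (Eventually.of_forall fun x => ENNReal.tendsto_coe.2 (hg x))
  refine ⟨fun s t h => ENNReal.toReal_mono (ne_top_of_le_ne_top hμ (hle t))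
    (hI.monotone_lintegral μ h), fun t => hlim _ (k t) (fun x => hI.right_cont x t)
      (ne_top_of_le_ne_top hμ (hle t)), ?_, ?_⟩
  · simpa using hlim atBot 0 hI.atBot (by simp)
  · exact ⟨_, forall_mem_range.2 fun t => ENNReal.toReal_mono hμ (hle t)⟩

lemma IsDF.isProbDF_div {G : ℝ → ℝ} (hG : IsDF G) {w : ℝ} (hw : 0 < w)
    (hGw : Tendsto G atTop (𝓝 w)) : IsProbDF fun t => G t / w where
  mono _ _ h := div_le_div_of_nonneg_right (hG.mono h) hw.le
  right_cont t := (hG.right_cont t).div_const w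
  atBot := by simpa using hG.atBot.div_const w
  bdd := ⟨1, forall_mem_range.2 fun t => (div_le_one hw).2 (hG.mono.ge_of_tendsto hGw t)⟩
  atTop := by simpa [hw.ne'] using hGw.div_const w

lemma condII_iff {νt : Measure (ℝ × ℝ)} : CondII kbar νt ↔ ∀ s : ℝ, 0 < s →
    ∫⁻ p in univ ×ˢ Ioi (0 : ℝ),
      (1 - expNeg (ENNReal.ofReal p.2 * (ENNReal.ofReal s * kbar p.1))) ∂νt < ∞ := by
  refine forall₂_congr fun s hs => ?_
  rw [setLIntegral_congr_fun (MeasurableSet.univ.prod measurableSet_Ioi) fun p hp => ?_]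
  have hp2 : 0 ≤ p.2 := le_of_lt hp.2
  have hk0 := (kbar p.1).coe_nonneg
  change ENNReal.ofReal (1 - Real.exp (-(s * p.2 * kbar p.1))) =
    1 - expNeg (ENNReal.ofReal p.2 * (ENNReal.ofReal s * kbar p.1))
  rw [← one_sub_expNeg_ofReal (by positivity), ENNReal.ofReal_mul (by positivity),
    ENNReal.ofReal_mul hs.le, ENNReal.ofReal_coe_nnreal]
  congr 2
  ring

end Kernel

/-! ### Finiteness and positivity of `∫ k̄ dL_A` -/

section Criteria

variable {Ω : Type*} [MeasurableSpace Ω] {P : Measure Ω} {κ : Ω → Measure ℝ}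
  {νt : Measure (ℝ × ℝ)} {kbar : ℝ → ℝ≥0}

lemma ae_lintegral_lt_top_iff_condII [IsProbabilityMeasure P] (hκ : Measurable κ) (hkb : Measurable kbar)
    (h : ∀ f : ℝ → ℝ≥0∞, Measurable f →
      HasPoissonLaplace P κ (νt.restrict (univ ×ˢ Ioi 0)) f) :
    (∀ᵐ ω ∂P, ∫⁻ x, (kbar x : ℝ≥0∞) ∂κ ω < ∞) ↔ CondII kbar νt := by
  set W : Ω → ℝ≥0∞ := fun ω => ∫⁻ x, (kbar x : ℝ≥0∞) ∂κ ω
  have hkm := hkb.coe_nnreal_ennreal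
  have hW : Measurable W := (Measure.measurable_lintegral hkm).comp hκ
  have hs : ∀ s : ℝ, ∫⁻ ω, expNeg (ENNReal.ofReal s * W ω) ∂P =
      expNeg (∫⁻ p in univ ×ˢ Ioi (0 : ℝ),
        (1 - expNeg (ENNReal.ofReal p.2 * (ENNReal.ofReal s * kbar p.1))) ∂νt) := fun s => by
    rw [← h (fun x => ENNReal.ofReal s * kbar x) (by fun_prop)]
    exact lintegral_congr fun ω => by rw [lintegral_const_mul _ hkm]
  rw [condII_iff]
  constructor
  · intro hfin s hs0
    -- An infinite exponent would force `E exp(-s W) = 0`, that is, `W = ∞` a.s.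
    rw [lt_top_iff_ne_top]
    intro htop
    have h0 := hs s
    rw [htop, expNeg_top, lintegral_eq_zero_iff (by fun_prop)] at h0
    obtain ⟨ω, h1, h2⟩ := (hfin.and h0).exists
    exact ENNReal.mul_ne_top ENNReal.ofReal_ne_top h1.ne (expNeg_eq_zero_iff.1 h2)
  · intro hII
    -- Values of `s` tending to `0` and at most `1`, so the integrand at `s = 1` dominates.
    set u : ℕ → ℝ := fun i => 1 / ((i : ℝ) + 1) with hu
    have hu0 : Tendsto u atTop (𝓝 0) := tendsto_one_div_add_atTop_nhds_zero_nat
    have hu1 : ∀ i, u i ≤ 1 := fun i => by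
      rw [hu]
      exact (div_le_one (by positivity)).2 (by simp)
    have hupos : ∀ i, 0 < u i := fun i => by positivity
    have hlim : Tendsto (fun i => ∫⁻ p in univ ×ˢ Ioi (0 : ℝ),
        (1 - expNeg (ENNReal.ofReal p.2 * (ENNReal.ofReal (u i) * kbar p.1))) ∂νt)
        atTop (𝓝 0) := by
      have := tendsto_lintegral_of_dominated_convergence (μ := νt.restrict (univ ×ˢ Ioi (0 : ℝ)))
        (F := fun i p => 1 - expNeg (ENNReal.ofReal p.2 * (ENNReal.ofReal (u i) * kbar p.1)))
        (f := fun _ => 0) _ (fun i => by fun_prop) (fun i => Eventually.of_forall fun p => ?_)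
        (hII 1 one_pos).ne (Eventually.of_forall fun p => ?_)
      · simpa using this
      · refine tsub_le_tsub_left (antitone_expNeg ?_) 1
        gcongr
        exact hu1 i
      · have h1 : Tendsto (fun i => ENNReal.ofReal p.2 * (ENNReal.ofReal (u i) * kbar p.1)) atTop
            (𝓝 (ENNReal.ofReal p.2 * (ENNReal.ofReal 0 * kbar p.1))) :=
          ENNReal.Tendsto.const_mul (ENNReal.Tendsto.mul_const (ENNReal.tendsto_ofReal hu0)
            (Or.inr ENNReal.coe_ne_top)) (Or.inr ENNReal.ofReal_ne_top)
        simpa using ENNReal.Tendsto.sub (tendsto_const_nhds (x := (1 : ℝ≥0∞)))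
          ((continuous_expNeg.tendsto _).comp h1) (Or.inl ENNReal.one_ne_top)
    have hlim1 := (continuous_expNeg.tendsto _).comp hlim
    rw [expNeg_zero] at hlim1
    have hset : MeasurableSet {ω | W ω < ∞} := measurableSet_lt hW measurable_const
    -- As `u i > 0`, `exp(-u i * W)` vanishes on `W = ∞` and is at most the indicator of `W < ∞`.
    have hle : 1 ≤ P {ω | W ω < ∞} := by
      refine le_of_tendsto' hlim1 fun i => ?_
      rw [Function.comp_apply, ← hs (u i), ← lintegral_indicator_one hset]
      refine lintegral_mono fun ω => ?_
      by_cases hω : W ω < ∞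
      · rw [indicator_of_mem (by exact hω)]
        exact expNeg_le_one _
      · have : W ω = ∞ := not_lt_top_iff.1 hω
        simp [this, ENNReal.mul_top, hupos i]
    exact (mem_ae_iff_prob_eq_one hset).2 (le_antisymm prob_le_one hle)

lemma ae_lintegral_pos_iff_condIII (hκ : Measurable κ) (hkb : Measurable kbar)
    (h : ∀ f : ℝ → ℝ≥0∞, Measurable f →
      HasPoissonLaplace P κ (νt.restrict (univ ×ˢ Ioi 0)) f)
    (hν0 : νt ({x | kbar x = 0} ×ˢ Ioi (0 : ℝ)) = 0) :
    (∀ᵐ ω ∂P, 0 < ∫⁻ x, (kbar x : ℝ≥0∞) ∂κ ω) ↔ CondIII νt := by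
  have hkm := hkb.coe_nnreal_ennreal
  have hW : Measurable fun ω => ∫⁻ x, (kbar x : ℝ≥0∞) ∂κ ω :=
    (Measure.measurable_lintegral hkm).comp hκ
  -- With `0 · ∞ = 0`, `exp(-∞ · W)` is the indicator of `W = 0`, and on the right the integrand is
  -- `1` wherever `v > 0` and `k̄ > 0`.
  have hlap := h (fun x => ∞ * kbar x) (by fun_prop)
  have hae : ∀ᵐ p ∂νt.restrict (univ ×ˢ Ioi (0 : ℝ)),
      1 - expNeg (ENNReal.ofReal p.2 * (∞ * kbar p.1)) = 1 := by
    have hk0 : ∀ᵐ p ∂νt.restrict (univ ×ˢ Ioi (0 : ℝ)), kbar p.1 ≠ 0 := by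
      rw [ae_iff, Measure.restrict_apply
        (by simpa using measurableSet_eq_fun (hkb.comp measurable_fst) measurable_const)]
      refine measure_mono_null (fun p hp => ?_) hν0
      exact ⟨by simpa using hp.1, hp.2.2⟩
    filter_upwards [hk0, ae_restrict_mem (MeasurableSet.univ.prod measurableSet_Ioi)] with p h1 h2
    have h3 : ENNReal.ofReal p.2 ≠ 0 := (ENNReal.ofReal_pos.2 h2.2).ne'
    rw [ENNReal.top_mul (by simpa using h1), ENNReal.mul_top h3]
    simp
  rw [HasPoissonLaplace, lintegral_congr_ae hae] at hlap
  simp only [lintegral_const_mul _ hkm, lintegral_one, Measure.restrict_apply_univ] at hlap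
  rw [CondIII, ← expNeg_eq_zero_iff, ← hlap, lintegral_eq_zero_iff (by fun_prop)]
  refine eventually_congr (Eventually.of_forall fun ω => ?_)
  rw [Pi.zero_apply, expNeg_eq_zero_iff, pos_iff_ne_zero, ENNReal.mul_eq_top]
  simpa using fun h => by simp [h]

end Criteria

end IAP

/-! ### Transfer to `Z`, `Z̄` and `F` -/

theorem mainTheorem6 {Ω : Type*} [MeasurableSpace Ω] (P : Measure Ω) [IsProbabilityMeasure P]
    (L : ℝ≥0 → Ω → ℝ) (hL : IAP.IsIncreasingAdditive L P)
    (ν : ℝ≥0 → Measure ℝ) (hν : IAP.HasLevyMeasures L ν P)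
    (α : Measure ℝ) [IsFiniteMeasure α] (hα : α ≠ 0)
    (νt : Measure (ℝ × ℝ)) (hνt : IAP.IsPoissonIntensity νt ν α)
    (k : ℝ → ℝ → ℝ≥0) (hk : ∀ t, Measurable (k t)) (hI : IAP.CondI k)
    (kbar : ℝ → ℝ≥0) (hkbar : ∀ x, Tendsto (fun t => k t x) atTop (𝓝 (kbar x))) :
    (∀ᵐ ω ∂P, Tendsto (fun t => IAP.Z k L α t ω) atTop (𝓝 (IAP.Zbar k L α ω))) ∧
    ((∀ᵐ ω ∂P, IAP.Zbar k L α ω < ∞) ↔ IAP.CondII kbar νt) ∧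
    (IAP.CondII kbar νt → IAP.IsRandomDF (IAP.Z k L α) P) ∧
    (νt ({x | kbar x = 0} ×ˢ Ioi (0 : ℝ)) = 0 →
      ((∀ᵐ ω ∂P, 0 < IAP.Zbar k L α ω) ↔ IAP.CondIII νt) ∧
      (IAP.CondII kbar νt → IAP.CondIII νt → IAP.IsRandomProbDF (IAP.F k L α) P)) := by
  obtain ⟨κ, hκm, hκfin, hκ⟩ := IAP.exists_measurable_version hL α
  have hkb : Measurable kbar := measurable_of_tendsto_metrizable (fun i : ℕ => hk i)
    (tendsto_pi_nhds.2 fun x => (hkbar x).comp tendsto_natCast_atTop_atTop)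
  have hlap : ∀ f : ℝ → ℝ≥0∞, Measurable f →
      IAP.HasPoissonLaplace P κ (νt.restrict (univ ×ˢ Ioi 0)) f := fun f hf =>
    IAP.hasPoissonLaplace hL hν hνt hκm hκ hf
  -- The measures themselves agree almost surely, so one null set serves all `t`.
  have hZ : ∀ᵐ ω ∂P, ∀ t, IAP.Z k L α t ω = ∫⁻ x, (k t x : ℝ≥0∞) ∂κ ω := by
    filter_upwards [hκ] with ω hω t
    rw [IAP.Z, hω]
  have hlimZ : ∀ ω, Tendsto (fun t => ∫⁻ x, (k t x : ℝ≥0∞) ∂κ ω) atTop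
      (𝓝 (∫⁻ x, (kbar x : ℝ≥0∞) ∂κ ω)) := fun ω =>
    IAP.tendsto_lintegral_kernel_atTop hk hI hkbar (κ ω)
  have hZbar : ∀ᵐ ω ∂P, IAP.Zbar k L α ω = ∫⁻ x, (kbar x : ℝ≥0∞) ∂κ ω := by
    filter_upwards [hZ] with ω hω
    simp only [IAP.Zbar, hω]
    exact (hlimZ ω).limUnder_eq
  have hZm : ∀ t, AEMeasurable (IAP.Z k L α t) P := fun t =>
    ⟨_, (Measure.measurable_lintegral (hk t).coe_nnreal_ennreal).comp hκm,
      hZ.mono fun ω hω => hω t⟩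
  have hZbarm : AEMeasurable (IAP.Zbar k L α) P :=
    ⟨_, (Measure.measurable_lintegral hkb.coe_nnreal_ennreal).comp hκm, hZbar⟩
  have hfin : (∀ᵐ ω ∂P, IAP.Zbar k L α ω < ∞) ↔ IAP.CondII kbar νt := by
    rw [← IAP.ae_lintegral_lt_top_iff_condII hκm hkb hlap]
    exact eventually_congr (hZbar.mono fun ω hω => by rw [hω])
  refine ⟨?_, hfin, fun hII => ⟨hZm, ?_⟩, fun hν0 => ?_⟩
  · filter_upwards [hZ, hZbar] with ω h1 h2
    simpa only [h1, h2] using hlimZ ω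
  · filter_upwards [hZ, hZbar, hfin.2 hII] with ω h1 h2 h3
    rw [h2] at h3
    simp only [h1]
    exact ⟨fun t => (lintegral_mono fun x => ENNReal.coe_le_coe.2
      (hI.le_kbar hkbar t x)).trans_lt h3, IAP.isDF_lintegral_kernel hk hI hkbar h3.ne⟩
  · have hpos : (∀ᵐ ω ∂P, 0 < IAP.Zbar k L α ω) ↔ IAP.CondIII νt := by
      rw [← IAP.ae_lintegral_pos_iff_condIII hκm hkb hlap hν0]
      exact eventually_congr (hZbar.mono fun ω hω => by rw [hω])
    refine ⟨hpos, fun hII hIII => ⟨fun t => ?_, ?_⟩⟩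
    · exact (hZm t).ennreal_toReal.div hZbarm.ennreal_toReal
    · filter_upwards [hZ, hZbar, hfin.2 hII, hpos.2 hIII] with ω h1 h2 h3 h4
      rw [h2] at h3 h4
      simp only [IAP.F, h1, h2]
      exact (IAP.isDF_lintegral_kernel hk hI hkbar h3.ne).isProbDF_div
        (ENNReal.toReal_pos h4.ne' h3.ne) ((ENNReal.tendsto_toReal h3.ne).comp (hlimZ ω))
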